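/- Let $G$ be a discrete group with identity $e$ and let $\sigma\colon G\times G\to\mathbb{T}$ be a normalized two-cocycle, i.e. $\sigma(g,h)\sigma(gh,k)=\sigma(h,k)\sigma(g,hk)$ and $\sigma(g,e)=\sigma(e,g)=1$ for all $g,h,k\in G$. Let $D^\sigma$ be the subgroup of $\mathbb{T}$ generated by $\sigma(G\times G)$, and let $G^\sigma$ be the set $G\times D^\sigma$ with the product $(g,z)(h,w)=(gh,\sigma(g,h)zw)$, regarded as a discrete group; it is a central extension of $G$ by $D^\sigma$. Let $C^*(G^\sigma)$ be the full group C$^*$-algebra of $G^\sigma$, and let $C^*_r(G,\sigma)$ be the C$^*$-algebra of operators on $\ell^2(G)$ generated by the operators $\lambda_\sigma(g)$, $g\in G$, given by $(\lambda_\sigma(g)\xi)(h)=\sigma(g,g^{-1}h)\,\xi(g^{-1}h)$. Ideals of C$^*$-algebras are closed and two-sided. An ideal $P$ is prime if it is proper and, for all ideals $I,J$ with $IJ\subseteq P$, one has $I\subseteq P$ or $J\subseteq P$; it is maximal if it is proper and contained in no other proper ideal. Assume that every prime ideal of $C^*(G^\sigma)$ is maximal. If $(G,\sigma)$ satisfies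 Kleppner's condition, that is, if every $g\neq e$ in $G$ that is $\sigma$-regular (meaning $\sigma(g,h)=\sigma(h,g)$ for every $h\in G$ commuting with $g$) has an infinite conjugacy class, then $C^*_r(G,\sigma)$ is simple, i.e. it is nonzero and its only closed two-sided ideals are $0$ and $C^*_r(G,\sigma)$. -/

import Mathlib

open scoped ENNReal

universe u

noncomputable section

namespace TwistedGroup

/-! ### Ideals of C⋆-algebras

As usual for C⋆-algebras, "ideal" means closed two-sided ideal. -/

section Ideals

variable {A : Type*} [Ring A] [TopologicalSpace A]

/-- A prime ideal: a proper closed two-sided ideal `P` such that, for closed two-sided ideals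
`I`, `J`, the inclusion `I J ⊆ P` implies `I ⊆ P` or `J ⊆ P`. -/
structure IsPrimeIdeal (P : TwoSidedIdeal A) : Prop where
  isClosed : IsClosed (P : Set A)
  ne_top : P ≠ ⊤
  le_or_le : ∀ I J : TwoSidedIdeal A, IsClosed (I : Set A) → IsClosed (J : Set A) →
    (∀ x ∈ I, ∀ y ∈ J, x * y ∈ P) → I ≤ P ∨ J ≤ P

/-- A maximal ideal: a proper closed two-sided ideal that is contained in no other proper closed
two-sided ideal. -/
structure IsMaximalIdeal (M : TwoSidedIdeal A) : Prop where
  isClosed : IsClosed (M : Set A)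
  ne_top : M ≠ ⊤
  eq_of_le : ∀ I : TwoSidedIdeal A, IsClosed (I : Set A) → I ≠ ⊤ → M ≤ I → I = M

variable (A) in
/-- Simplicity of a C⋆-algebra: it is nonzero and its only closed two-sided ideals are `0` and
the whole algebra. -/
structure IsSimpleCStar : Prop where
  nontrivial : Nontrivial A
  eq_bot_or_eq_top : ∀ I : TwoSidedIdeal A, IsClosed (I : Set A) → I = ⊥ ∨ I = ⊤

end Ideals

/-! ### The full C⋆-algebra of a discrete group -/

/-- A unitary representation of the discrete group `Γ` on a nonzero complex Hilbert space. The
Hilbert spaces range over the universe of `Γ`; since a cyclic representation acts on a space whose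
Hilbert dimension is at most `max |Γ| ℵ₀`, every cyclic representation occurs up to unitary
equivalence, so the supremum of `‖π(f)‖` over these `π` is the full universal norm of `f`. -/
structure UnitaryRep (Γ : Type u) [Group Γ] where
  H : Type u
  [normedAddCommGroup : NormedAddCommGroup H]
  [innerProductSpace : InnerProductSpace ℂ H]
  [completeSpace : CompleteSpace H]
  [nontrivial : Nontrivial H]
  toHom : Γ →* unitary (H →L[ℂ] H)

attribute [instance] UnitaryRep.normedAddCommGroup UnitaryRep.innerProductSpace
  UnitaryRep.completeSpace UnitaryRep.nontrivial

/-- The C⋆-algebra of all bounded families `(T_π)`, indexed by the unitary representations `π` of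
`Γ`, with `T_π` a bounded operator on the space of `π`, under the supremum norm. These are the
block-diagonal operators on the Hilbert space of the universal representation. -/
abbrev UniversalOperators (Γ : Type u) [Group Γ] : Type (u + 1) :=
  lp (fun π : UnitaryRep Γ => (π.H →L[ℂ] π.H)) ∞

/-- The universal representation `γ ↦ (π(γ))_π`. -/
def universalRep (Γ : Type u) [Group Γ] (γ : Γ) : UniversalOperators Γ :=
  ⟨fun π => (π.toHom γ : π.H →L[ℂ] π.H), memℓp_infty ⟨1, by
    rintro _ ⟨π, rfl⟩
    exact CStarRing.norm_of_mem_unitary (π.toHom γ).2 |>.le⟩⟩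

/-- The full group C⋆-algebra `C⋆(Γ)` of the discrete group `Γ`: the enveloping C⋆-algebra of
`ℓ¹(Γ)`, that is, the C⋆-algebra generated by the image of `Γ` under the universal unitary
representation. -/
abbrev GroupCStarAlgebra (Γ : Type u) [Group Γ] : Type (u + 1) :=
  (StarAlgebra.adjoin ℂ (Set.range (universalRep Γ))).topologicalClosure

/-! ### Two-cocycles -/

/-- Normalized two-cocycles on `G` with values in the circle group. -/
structure TwoCocycle (G : Type u) [Group G] where
  toFun : G → G → Circle
  cocycle : ∀ g h k, toFun g h * toFun (g * h) k = toFun h k * toFun g (h * k)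
  map_one_right : ∀ g, toFun g 1 = 1
  map_one_left : ∀ g, toFun 1 g = 1

namespace TwoCocycle

variable {G : Type u} [Group G]

instance : CoeFun (TwoCocycle G) fun _ => G → G → Circle := ⟨toFun⟩

variable (σ : TwoCocycle G)

/-- `g` is `σ`-regular if `σ(g,h) = σ(h,g)` whenever `h` commutes with `g`. -/
def IsRegular (g : G) : Prop := ∀ h : G, Commute h g → σ g h = σ h g

/-- Kleppner's condition: every nontrivial `σ`-regular conjugacy class of `G` is infinite. -/
def Kleppner : Prop := ∀ g : G, g ≠ 1 → σ.IsRegular g → (conjugatesOf g).Infinite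

/-! ### The reduced twisted group C⋆-algebra -/

/-- The formula `(λ_σ(g) ξ)(h) = σ(g, g⁻¹h) ξ(g⁻¹h)`. -/
def regularFun (g : G) (ξ : G → ℂ) (h : G) : ℂ := (σ g (g⁻¹ * h) : ℂ) * ξ (g⁻¹ * h)

lemma norm_regularFun_apply (g : G) (ξ : G → ℂ) (h : G) :
    ‖σ.regularFun g ξ h‖ = ‖ξ (g⁻¹ * h)‖ := by
  rw [regularFun, norm_mul, Circle.norm_coe, one_mul]

lemma memℓp_regularFun (g : G) (ξ : lp (fun _ : G => ℂ) 2) : Memℓp (σ.regularFun g ξ) 2 := by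
  have h := (memℓp_gen_iff (by norm_num)).1 (lp.memℓp ξ)
  refine memℓp_gen ?_
  simp only [norm_regularFun_apply]
  exact (Equiv.mulLeft g⁻¹).summable_iff.2 h

lemma norm_regularFun (g : G) (ξ : lp (fun _ : G => ℂ) 2) :
    ‖(⟨σ.regularFun g ξ, σ.memℓp_regularFun g ξ⟩ : lp (fun _ : G => ℂ) 2)‖ = ‖ξ‖ := by
  rw [lp.norm_eq_tsum_rpow (by norm_num), lp.norm_eq_tsum_rpow (by norm_num)]
  simp only [norm_regularFun_apply]
  congr 1
  exact (Equiv.mulLeft g⁻¹).tsum_eq (fun h => ‖ξ h‖ ^ (2 : ℝ≥0∞).toReal)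

/-- The left regular `σ`-projective unitary representation `λ_σ` of `G` on `ℓ²(G)`. -/
def regularRep (g : G) : lp (fun _ : G => ℂ) 2 →L[ℂ] lp (fun _ : G => ℂ) 2 :=
  LinearIsometry.toContinuousLinearMap
    { toFun := fun ξ => ⟨σ.regularFun g ξ, σ.memℓp_regularFun g ξ⟩
      map_add' := fun ξ η => by
        ext h
        exact mul_add _ _ _
      map_smul' := fun c ξ => by
        ext h
        exact mul_left_comm _ _ _
      norm_map' := σ.norm_regularFun g }

/-- The reduced twisted group C⋆-algebra `C⋆_r(G,σ)`: the C⋆-algebra generated by `λ_σ(G)`. -/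
abbrev ReducedCStarAlgebra : Type u :=
  (StarAlgebra.adjoin ℂ (Set.range σ.regularRep)).topologicalClosure

/-! ### The central extension -/

/-- `D^σ`: the subgroup of the circle group generated by the values of `σ`. -/
def valueGroup : Subgroup Circle := Subgroup.closure {z | ∃ g h, σ g h = z}

/-- The underlying set `G × D^σ` of the extension `G^σ` of `G` by `D^σ`. -/
@[ext]
structure Extension (σ : TwoCocycle G) : Type u where
  fst : G
  snd : σ.valueGroup

/-- `σ(g,h)` as an element of `D^σ`. -/
def value (g h : G) : σ.valueGroup := ⟨σ g h, Subgroup.subset_closure ⟨g, h, rfl⟩⟩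

namespace Extension

variable {σ}

/-- `(g,z)(h,w) = (gh, σ(g,h)zw)`. -/
instance : Mul σ.Extension := ⟨fun a b => ⟨a.fst * b.fst, σ.value a.fst b.fst * a.snd * b.snd⟩⟩

instance : One σ.Extension := ⟨⟨1, 1⟩⟩

instance : Inv σ.Extension := ⟨fun a => ⟨a.fst⁻¹, (σ.value a.fst⁻¹ a.fst)⁻¹ * a.snd⁻¹⟩⟩

lemma mul_def (a b : σ.Extension) :
    a * b = ⟨a.fst * b.fst, σ.value a.fst b.fst * a.snd * b.snd⟩ := rfl

lemma one_def : (1 : σ.Extension) = ⟨1, 1⟩ := rfl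

lemma inv_def (a : σ.Extension) :
    a⁻¹ = ⟨a.fst⁻¹, (σ.value a.fst⁻¹ a.fst)⁻¹ * a.snd⁻¹⟩ := rfl

/-- The group `G^σ`, regarded as a discrete group. -/
instance : Group σ.Extension :=
  Group.ofLeftAxioms
    (fun a b c => by
      have h : σ.value a.fst b.fst * σ.value (a.fst * b.fst) c.fst =
          σ.value b.fst c.fst * σ.value a.fst (b.fst * c.fst) :=
        Subtype.ext (σ.cocycle a.fst b.fst c.fst)
      simp only [mul_def, mul_assoc, Extension.mk.injEq, true_and]
      calc _ = (σ.value a.fst b.fst * σ.value (a.fst * b.fst) c.fst) *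
            (a.snd * (b.snd * c.snd)) := by
              simp only [mul_assoc, mul_left_comm]
        _ = _ := by rw [h]; simp only [mul_assoc, mul_left_comm])
    (fun a => by
      have h : σ.value 1 a.fst = 1 := Subtype.ext (σ.map_one_left a.fst)
      ext <;> simp [mul_def, one_def, h])
    (fun a => by
      ext <;> simp [mul_def, one_def, inv_def])

end Extension

end TwoCocycle

end TwistedGroup

end

/-! The representation `(g, z) ↦ z λ_σ(g)` of `G^σ` integrates to a surjection `toReduced` from
`C⋆(G^σ)` onto `C⋆_r(G,σ)`. Proper closed ideals of the quotient pull back to proper closed ideals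
containing the kernel, so simplicity follows once the kernel is maximal; by hypothesis it is enough
that it be prime.

Primeness comes from `Kleppner.eq_bot_or_eq_top`: `λ_σ` and the commuting right representation `ρ_σ`
are jointly irreducible. If `IJ` lies in the kernel, the common null space of the image of `I` is
closed, invariant under both, and contains the ranges of the image of `J`. If it is zero, `J` lies
in the kernel; if it is everything, `I` does.

For irreducibility, the projection of `δ_1` onto an invariant subspace is fixed by all
`λ_σ(g)ρ_σ(g)`. Such a vector vanishes at nonregular points and has constant modulus on conjugacy
classes, so under Kleppner's condition square-summability makes it a multiple of `δ_1`, which is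
cyclic for `λ_σ`. -/

noncomputable section

/-! ### Closed range of star homomorphisms -/

namespace StarAlgHom

variable {A B : Type*} [CStarAlgebra A] [CStarAlgebra B]

/-- A selfadjoint element in the range of a star homomorphism lifts to an element of no larger
norm: truncate any selfadjoint lift by functional calculus. -/
lemma exists_norm_le_of_isSelfAdjoint (φ : A →⋆ₐ[ℂ] B) {a : A} (ha : IsSelfAdjoint a) :
    ∃ a' : A, φ a' = φ a ∧ ‖a'‖ ≤ ‖φ a‖ := by
  have hφ : Continuous φ := by
    open scoped CStarAlgebra in exact map_continuous φ
  have hb : IsSelfAdjoint (φ a) := ha.map φ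
  set c := ‖φ a‖ with hc
  have hc0 : 0 ≤ c := norm_nonneg _
  have hf : Continuous fun x : ℝ => max (-c) (min c x) := by fun_prop
  refine ⟨cfc (fun x : ℝ => max (-c) (min c x)) a, ?_, ?_⟩
  · rw [StarAlgHom.map_cfc (S := ℂ) φ _ a hf.continuousOn hφ ha hb]
    conv_rhs => rw [← cfc_id ℝ (φ a)]
    -- The spectrum of `φ a` lies in `[-c, c]`, where the truncation is the identity.
    refine cfc_congr fun x hx => ?_
    have hx' : |x| ≤ c := by
      rcases subsingleton_or_nontrivial B with h | h
      · simp [spectrum.of_subsingleton] at hx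
      · simpa using spectrum.norm_le_norm_of_mem hx
    rw [abs_le] at hx'
    simp [hx'.1, hx'.2]
  · refine norm_cfc_le hc0 fun x _ => ?_
    rw [Real.norm_eq_abs, abs_le]
    exact ⟨le_max_left _ _, max_le (by linarith) (min_le_left _ _)⟩

/-- Lift real and imaginary parts separately. Any uniform constant would do for the closed range
theorem. -/
lemma exists_norm_le (φ : A →⋆ₐ[ℂ] B) (a : A) :
    ∃ a' : A, φ a' = φ a ∧ ‖a'‖ ≤ 2 * ‖φ a‖ := by
  have hφ : Continuous φ := by
    open scoped CStarAlgebra in exact map_continuous φ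
  obtain ⟨x, hx, hxn⟩ := φ.exists_norm_le_of_isSelfAdjoint (realPart a).2
  obtain ⟨y, hy, hyn⟩ := φ.exists_norm_le_of_isSelfAdjoint (imaginaryPart a).2
  have hre : φ (realPart a : A) = (realPart (φ a) : B) := by
    simp [realPart_apply_coe, map_real_smul φ hφ, map_star]
  have him : φ (imaginaryPart a : A) = (imaginaryPart (φ a) : B) := by
    simp [imaginaryPart_apply_coe, map_real_smul φ hφ, map_star]
  refine ⟨x + Complex.I • y, ?_, ?_⟩
  · rw [map_add, map_smul, hx, hy, hre, him, realPart_add_I_smul_imaginaryPart]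
  · rw [hre] at hxn
    rw [him] at hyn
    calc ‖x + Complex.I • y‖ ≤ ‖x‖ + ‖y‖ := by
          refine (norm_add_le _ _).trans ?_
          rw [norm_smul, Complex.norm_I, one_mul]
      _ ≤ ‖φ a‖ + ‖φ a‖ := add_le_add (hxn.trans (realPart.norm_le (φ a)))
          (hyn.trans (imaginaryPart.norm_le (φ a)))
      _ = 2 * ‖φ a‖ := (two_mul _).symm

/-- The range of a star homomorphism between C⋆-algebras is closed. -/
theorem isClosed_range_of_cstarAlgebra (φ : A →⋆ₐ[ℂ] B) : IsClosed (Set.range φ) := by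
  open scoped CStarAlgebra in
  let f : NormedAddGroupHom A B :=
    AddMonoidHom.mkNormedAddGroupHom (φ : A →+ B) 1 fun a => by
      simpa using NonUnitalStarAlgHom.norm_apply_le φ a
  have h : f.SurjectiveOnWith f.range 2 := by
    rintro _ ⟨a, rfl⟩
    exact φ.exists_norm_le a
  have h' := controlled_closure_of_complete two_pos one_pos h
  rw [← closure_subset_iff_isClosed]
  intro b hb
  obtain ⟨a, ha, -⟩ := h' b hb
  exact ⟨a, ha⟩

end StarAlgHom

namespace TwistedGroup

instance (Γ : Type u) [Group Γ] : CStarAlgebra (UniversalOperators Γ) where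

instance (Γ : Type u) [Group Γ] : CStarAlgebra (GroupCStarAlgebra Γ) :=
  StarSubalgebra.cstarAlgebra _ (h_closed := StarSubalgebra.isClosed_topologicalClosure _)

end TwistedGroup

/-! ### Regular representations and their joint irreducibility -/

namespace TwistedGroup

namespace TwoCocycle

variable {G : Type u} [Group G] (σ : TwoCocycle G)

lemma regularRep_apply (g : G) (ξ : lp (fun _ : G => ℂ) 2) (h : G) :
    σ.regularRep g ξ h = (σ g (g⁻¹ * h) : ℂ) * ξ (g⁻¹ * h) := rfl

lemma norm_regularRep_apply (g : G) (ξ : lp (fun _ : G => ℂ) 2) :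
    ‖σ.regularRep g ξ‖ = ‖ξ‖ :=
  σ.norm_regularFun g ξ

lemma coe_cocycle (g h k : G) :
    (σ g h : ℂ) * σ (g * h) k = σ h k * σ g (h * k) := by
  exact_mod_cast congrArg Subtype.val (σ.cocycle g h k)

lemma regularRep_one : σ.regularRep 1 = 1 := by
  ext ξ h
  simp [regularRep_apply, σ.map_one_left]

lemma regularRep_mul_regularRep (g h : G) :
    σ.regularRep g * σ.regularRep h = (σ g h : ℂ) • σ.regularRep (g * h) := by
  ext ξ k
  have := σ.coe_cocycle g h (h⁻¹ * (g⁻¹ * k))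
  simp only [mul_inv_cancel_left] at this
  simp only [mul_apply_eq_comp, smul_apply, lp.coeFn_smul,
    Pi.smul_apply, smul_eq_mul, regularRep_apply, mul_inv_rev, mul_assoc]
  linear_combination (-ξ (h⁻¹ * (g⁻¹ * k))) * this

/-! ### The unitary representation of the extension defined by the regular representation -/

/-- The operator `z λ_σ(g)` attached to the element `(g, z)` of the extension. -/
def extensionOperator (a : σ.Extension) :
    lp (fun _ : G => ℂ) 2 →L[ℂ] lp (fun _ : G => ℂ) 2 :=
  ((a.snd : Circle) : ℂ) • σ.regularRep a.fst

lemma extensionOperator_one : σ.extensionOperator 1 = 1 := by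
  simp [extensionOperator, Extension.one_def, regularRep_one]

lemma extensionOperator_mul (a b : σ.Extension) :
    σ.extensionOperator (a * b) = σ.extensionOperator a * σ.extensionOperator b := by
  simp only [extensionOperator, Extension.mul_def, smul_mul_assoc, mul_smul_comm,
    regularRep_mul_regularRep, smul_smul, value, Subgroup.coe_mul, Circle.coe_mul]
  congr 1
  ring

lemma norm_extensionOperator_apply (a : σ.Extension) (ξ : lp (fun _ : G => ℂ) 2) :
    ‖σ.extensionOperator a ξ‖ = ‖ξ‖ := by
  rw [extensionOperator, smul_apply, norm_smul, Circle.norm_coe, one_mul,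
    norm_regularRep_apply]

lemma star_extensionOperator_mul_self (a : σ.Extension) :
    star (σ.extensionOperator a) * σ.extensionOperator a = 1 :=
  (ContinuousLinearMap.norm_map_iff_adjoint_comp_self _).1 (σ.norm_extensionOperator_apply a)

lemma star_extensionOperator (a : σ.Extension) :
    star (σ.extensionOperator a) = σ.extensionOperator a⁻¹ := by
  refine left_inv_eq_right_inv (σ.star_extensionOperator_mul_self a) ?_
  rw [← extensionOperator_mul, mul_inv_cancel, extensionOperator_one]

lemma extensionOperator_mem_unitary (a : σ.Extension) :
    σ.extensionOperator a ∈ unitary (lp (fun _ : G => ℂ) 2 →L[ℂ] lp (fun _ : G => ℂ) 2) := by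
  refine Unitary.mem_iff.2 ⟨σ.star_extensionOperator_mul_self a, ?_⟩
  rw [star_extensionOperator, ← extensionOperator_mul, mul_inv_cancel, extensionOperator_one]

instance : Nontrivial (lp (fun _ : G => ℂ) 2) := by
  classical
  refine ⟨lp.single 2 1 1, 0, fun h => ?_⟩
  have := congrArg (fun ξ : lp (fun _ : G => ℂ) 2 => ξ 1) h
  simp at this

/-- The unitary representation `(g, z) ↦ z λ_σ(g)` of the extension. -/
def extensionRep : UnitaryRep σ.Extension where
  H := lp (fun _ : G => ℂ) 2
  toHom :=
    { toFun := fun a => ⟨σ.extensionOperator a, σ.extensionOperator_mem_unitary a⟩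
      map_one' := Subtype.ext σ.extensionOperator_one
      map_mul' := fun a b => Subtype.ext (σ.extensionOperator_mul a b) }

lemma regularRep_eq_extensionOperator (g : G) :
    σ.regularRep g = σ.extensionOperator ⟨g, 1⟩ := by
  simp [extensionOperator]

/-! ### The right regular representation -/

/-- The formula `(ρ_σ(g) ξ)(h) = σ(h, g)⁻¹ ξ(hg)`. -/
def rightRegularFun (g : G) (ξ : G → ℂ) (h : G) : ℂ := ((σ h g)⁻¹ : Circle) * ξ (h * g)

lemma norm_rightRegularFun_apply (g : G) (ξ : G → ℂ) (h : G) :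
    ‖σ.rightRegularFun g ξ h‖ = ‖ξ (h * g)‖ := by
  rw [rightRegularFun, norm_mul, Circle.norm_coe, one_mul]

lemma memℓp_rightRegularFun (g : G) (ξ : lp (fun _ : G => ℂ) 2) :
    Memℓp (σ.rightRegularFun g ξ) 2 := by
  have h := (memℓp_gen_iff (by norm_num)).1 (lp.memℓp ξ)
  refine memℓp_gen ?_
  simp only [norm_rightRegularFun_apply]
  exact (Equiv.mulRight g).summable_iff.2 h

/-- The right regular projective representation, which commutes with `λ_σ`. -/
def rightRegularRep (g : G) : lp (fun _ : G => ℂ) 2 →ₗᵢ[ℂ] lp (fun _ : G => ℂ) 2 where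
  toFun := fun ξ => ⟨σ.rightRegularFun g ξ, σ.memℓp_rightRegularFun g ξ⟩
  map_add' := fun ξ η => by
    ext h
    exact mul_add _ _ _
  map_smul' := fun c ξ => by
    ext h
    exact mul_left_comm _ _ _
  norm_map' := fun ξ => by
    rw [lp.norm_eq_tsum_rpow (by norm_num), lp.norm_eq_tsum_rpow (by norm_num)]
    congr 1
    exact (tsum_congr fun h => congrArg (· ^ (2 : ℝ≥0∞).toReal)
      (σ.norm_rightRegularFun_apply g ξ h)).trans
      ((Equiv.mulRight g).tsum_eq (fun h => ‖ξ h‖ ^ (2 : ℝ≥0∞).toReal))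

lemma rightRegularRep_apply (g : G) (ξ : lp (fun _ : G => ℂ) 2) (h : G) :
    σ.rightRegularRep g ξ h = ((σ h g)⁻¹ : Circle) * ξ (h * g) := rfl

lemma rightRegularRep_rightRegularRep_inv (g : G) (ξ : lp (fun _ : G => ℂ) 2) :
    σ.rightRegularRep g (σ.rightRegularRep g⁻¹ ξ) = (((σ g g⁻¹)⁻¹ : Circle) : ℂ) • ξ := by
  ext h
  have := σ.cocycle h g g⁻¹
  rw [mul_inv_cancel, σ.map_one_right, mul_one] at this
  simp only [rightRegularRep_apply, lp.coeFn_smul, Pi.smul_apply, smul_eq_mul,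
    mul_inv_cancel_right, ← this, mul_inv, Circle.coe_mul]
  rw [mul_assoc]

/-- This is the cocycle identity at `(k, k⁻¹h, g)`. -/
lemma rightRegularRep_regularRep (g k : G) (ξ : lp (fun _ : G => ℂ) 2) :
    σ.rightRegularRep g (σ.regularRep k ξ) = σ.regularRep k (σ.rightRegularRep g ξ) := by
  ext h
  have := σ.cocycle k (k⁻¹ * h) g
  rw [mul_inv_cancel_left] at this
  have key : (σ h g)⁻¹ * σ k (k⁻¹ * h * g) = σ k (k⁻¹ * h) * (σ (k⁻¹ * h) g)⁻¹ := by
    rw [inv_mul_eq_iff_eq_mul, ← mul_assoc, eq_mul_inv_iff_mul_eq, mul_comm (σ h g), this,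
      mul_comm, mul_assoc]
  have key' := congrArg (fun z : Circle => (z : ℂ)) key
  simp only [Circle.coe_mul] at key'
  simp only [rightRegularRep_apply, regularRep_apply, ← mul_assoc] at key' ⊢
  rw [key']

/-- The elements of the reduced algebra commute with the right regular representation. -/
lemma apply_rightRegularRep (T : σ.ReducedCStarAlgebra) (g : G) (ξ : lp (fun _ : G => ℂ) 2) :
    (T : lp (fun _ : G => ℂ) 2 →L[ℂ] lp (fun _ : G => ℂ) 2) (σ.rightRegularRep g ξ) =
      σ.rightRegularRep g
        ((T : lp (fun _ : G => ℂ) 2 →L[ℂ] lp (fun _ : G => ℂ) 2) ξ) := by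
  have hT := StarSubalgebra.topologicalClosure_adjoin_le_centralizer_centralizer ℂ _ T.2
  have hext (a : σ.Extension) : σ.extensionOperator a *
      (σ.rightRegularRep g).toContinuousLinearMap =
      (σ.rightRegularRep g).toContinuousLinearMap * σ.extensionOperator a := by
    ext1 η
    simp [extensionOperator, rightRegularRep_regularRep]
  have hρ : (σ.rightRegularRep g).toContinuousLinearMap ∈
      StarSubalgebra.centralizer ℂ (Set.range σ.regularRep) := by
    rw [StarSubalgebra.mem_centralizer_iff]
    rintro _ ⟨k, rfl⟩
    -- The centralizer also requires commutation with adjoints, which are again extension operators.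
    rw [regularRep_eq_extensionOperator, star_extensionOperator]
    exact ⟨hext _, hext _⟩
  have := ((StarSubalgebra.mem_centralizer_iff ℂ).1 hT _ hρ).1
  exact (congrArg (fun S => S ξ) this).symm

/-! ### Irreducibility of the left and right regular representations -/

/-- A square-summable function invariant under the twisted conjugation action is supported at the
identity if Kleppner's condition holds. -/
lemma Kleppner.apply_eq_zero {σ : TwoCocycle G} (hK : σ.Kleppner)
    {x : lp (fun _ : G => ℂ) 2}
    (hx : ∀ g, σ.regularRep g (σ.rightRegularRep g x) = x) {h : G} (hh : h ≠ 1) : x h = 0 := by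
  have hx' (g h : G) :
      (σ g (g⁻¹ * h) : ℂ) * (((σ (g⁻¹ * h) g)⁻¹ : Circle) * x (g⁻¹ * h * g)) = x h := by
    conv_rhs => rw [← hx g]
    rfl
  by_cases hreg : σ.IsRegular h
  · by_contra h0
    have hnorm : ∀ k ∈ conjugatesOf h, ‖x k‖ = ‖x h‖ := by
      rintro k hk
      obtain ⟨c, rfl⟩ := isConj_iff.1 hk
      rw [← hx' c (c * h * c⁻¹)]
      rw [norm_mul, norm_mul, Circle.norm_coe, Circle.norm_coe, one_mul, one_mul]
      simp [mul_assoc]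
    have hs := (memℓp_gen_iff (by norm_num)).1 (lp.memℓp x)
    have hfin := hs.tendsto_cofinite_zero.eventually_lt_const
      (show (0 : ℝ) < ‖x h‖ ^ (2 : ℝ≥0∞).toReal by positivity)
    refine hK h hh hreg (Set.Finite.subset (Filter.eventually_cofinite.1 hfin) fun k hk => ?_)
    simp [hnorm k hk]
  · simp only [IsRegular, not_forall] at hreg
    obtain ⟨g, hg, hne⟩ := hreg
    have hc := hx' g h
    have hgh : g⁻¹ * h * g = h := by rw [mul_assoc, ← hg.eq, inv_mul_cancel_left]
    have hcoc := σ.cocycle g (g⁻¹ * h) g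
    rw [mul_inv_cancel_left, hgh] at hcoc
    rw [hgh, ← mul_assoc, ← Circle.coe_mul] at hc
    by_contra h0
    -- Invariance at a point where `x` is nonzero forces this phase to be trivial; the cocycle
    -- identity at `(g, g⁻¹h, g)` then gives `σ(g,h) = σ(h,g)`.
    have h1 : σ g (g⁻¹ * h) * (σ (g⁻¹ * h) g)⁻¹ = 1 := by
      ext
      simpa using mul_right_cancel₀ h0 (hc.trans (one_mul _).symm)
    rw [mul_inv_eq_one] at h1
    rw [h1] at hcoc
    exact hne (mul_left_cancel hcoc)

lemma regularRep_single [DecidableEq G] (g : G) :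
    σ.regularRep g (lp.single 2 1 1) = lp.single 2 g 1 := by
  ext h
  rw [regularRep_apply]
  by_cases hgh : h = g
  · subst hgh
    simp [σ.map_one_right]
  · have : g⁻¹ * h ≠ 1 := fun h' => hgh (inv_mul_eq_one.1 h').symm
    simp [this, hgh]

lemma map_inv_right_comm (g : G) : σ g g⁻¹ = σ g⁻¹ g := by
  have := σ.cocycle g g⁻¹ g
  rwa [mul_inv_cancel, inv_mul_cancel, σ.map_one_left, σ.map_one_right, mul_one, mul_one] at this

lemma regularRep_rightRegularRep_single [DecidableEq G] (g : G) :
    σ.regularRep g (σ.rightRegularRep g (lp.single 2 1 1)) = lp.single 2 1 1 := by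
  ext h
  rw [regularRep_apply, rightRegularRep_apply]
  by_cases hh : h = 1
  · subst hh
    simp [σ.map_inv_right_comm]
  · have : g⁻¹ * h * g ≠ 1 := fun h' => hh (by
      rwa [mul_assoc, inv_mul_eq_one, eq_comm, mul_eq_right] at h')
    simp [this, hh]

lemma eq_top_of_single_mem [DecidableEq G] {V : Submodule ℂ (lp (fun _ : G => ℂ) 2)}
    (hV : IsClosed (V : Set (lp (fun _ : G => ℂ) 2)))
    (hl : ∀ g, ∀ ξ ∈ V, σ.regularRep g ξ ∈ V) (h1 : lp.single 2 1 1 ∈ V) : V = ⊤ := by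
  refine eq_top_iff.2 fun ξ _ => ?_
  have hs := lp.hasSum_single (p := 2) (by norm_num) ξ
  refine hV.mem_of_tendsto hs (Filter.Eventually.of_forall fun s => V.sum_mem fun g _ => ?_)
  have : lp.single 2 g (ξ g) = ξ g • (lp.single 2 g 1 : lp (fun _ : G => ℂ) 2) := by
    rw [← lp.single_smul, smul_eq_mul, mul_one]
  rw [this, ← σ.regularRep_single]
  exact V.smul_mem _ (hl g _ h1)

/-- Up to a nonzero scalar `T` is the adjoint of `S`. For projective representations, `T` is the
operator of the inverse group element. -/
lemma orthogonal_invariant {E : Type*} [NormedAddCommGroup E] [InnerProductSpace ℂ E]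
    {V : Submodule ℂ E} {S T : E → E} (hS : ∀ x y, inner ℂ (S x) (S y) = inner ℂ x y)
    (hT : ∀ x ∈ V, T x ∈ V) {c : ℂ} (hc : c ≠ 0) (hST : ∀ x, S (T x) = c • x)
    {y : E} (hy : y ∈ Vᗮ) : S y ∈ Vᗮ := by
  rw [Submodule.mem_orthogonal] at hy ⊢
  intro x hx
  have h : inner ℂ (c • x) (S y) = 0 := by
    rw [← hST, hS]
    exact hy _ (hT x hx)
  simpa [inner_smul_left, hc] using h

/-- If Kleppner's condition holds, then the left and right regular representations have no common
nontrivial closed invariant subspace. -/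
theorem Kleppner.eq_bot_or_eq_top {σ : TwoCocycle G} (hK : σ.Kleppner)
    {V : Submodule ℂ (lp (fun _ : G => ℂ) 2)}
    (hV : IsClosed (V : Set (lp (fun _ : G => ℂ) 2)))
    (hl : ∀ g, ∀ ξ ∈ V, σ.regularRep g ξ ∈ V)
    (hr : ∀ g, ∀ ξ ∈ V, σ.rightRegularRep g ξ ∈ V) : V = ⊥ ∨ V = ⊤ := by
  classical
  have : CompleteSpace V := hV.completeSpace_coe
  have hl' (g : G) (ξ) (hξ : ξ ∈ Vᗮ) : σ.regularRep g ξ ∈ Vᗮ := by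
    refine orthogonal_invariant (S := σ.regularRep g) (T := σ.regularRep g⁻¹)
      (c := (σ g g⁻¹ : ℂ)) (fun x y => ?_) (hl g⁻¹) (Circle.coe_ne_zero _) (fun x => ?_) hξ
    · rw [regularRep_eq_extensionOperator]
      exact ContinuousLinearMap.inner_map_map_of_mem_unitary (σ.extensionOperator_mem_unitary _) x y
    · rw [← mul_apply_eq_comp, regularRep_mul_regularRep, mul_inv_cancel,
        regularRep_one]
      rfl
  have hr' (g : G) (ξ) (hξ : ξ ∈ Vᗮ) : σ.rightRegularRep g ξ ∈ Vᗮ :=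
    orthogonal_invariant (S := σ.rightRegularRep g) (T := σ.rightRegularRep g⁻¹)
      (σ.rightRegularRep g).inner_map_map (hr g⁻¹) (Circle.coe_ne_zero _)
      (σ.rightRegularRep_rightRegularRep_inv g) hξ
  obtain ⟨x, hx, y, hy, hxy⟩ := V.exists_add_mem_mem_orthogonal (lp.single 2 1 1)
  have hinv (g : G) : σ.regularRep g (σ.rightRegularRep g x) = x := by
    -- `U` fixes `δ_1 = x + y` and preserves `V` and `Vᗮ`, so it fixes each component.
    set U := fun ξ => σ.regularRep g (σ.rightRegularRep g ξ) with hU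
    have hsum : U x + U y = x + y := by
      rw [← hxy, ← σ.regularRep_rightRegularRep_single g, hxy]
      simp [hU]
    have hmem : U x - x ∈ V := V.sub_mem (hl g _ (hr g _ hx)) hx
    have hmem' : U x - x ∈ Vᗮ := by
      rw [show U x - x = y - U y by rw [sub_eq_sub_iff_add_eq_add, hsum, add_comm]]
      exact Vᗮ.sub_mem hy (hl' g _ (hr' g _ hy))
    exact sub_eq_zero.1 (Submodule.disjoint_def.1 V.orthogonal_disjoint _ hmem hmem')
  have hx1 : x = x 1 • (lp.single 2 1 1 : lp (fun _ : G => ℂ) 2) := by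
    ext h
    by_cases hh : h = 1
    · subst hh
      simp
    · simp [hK.apply_eq_zero hinv hh, hh]
  by_cases h0 : x 1 = 0
  · left
    rw [h0, zero_smul] at hx1
    rw [hx1, zero_add] at hxy
    have := σ.eq_top_of_single_mem V.isClosed_orthogonal hl' (hxy ▸ hy)
    exact (Submodule.orthogonal_eq_top_iff _).1 this
  · right
    refine σ.eq_top_of_single_mem hV hl ?_
    have := V.smul_mem (x 1)⁻¹ hx
    rwa [hx1, smul_smul, lp.coeFn_smul, Pi.smul_apply, smul_eq_mul, lp.single_apply_self, mul_one,
      inv_mul_cancel₀ h0, one_smul] at this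

end TwoCocycle

end TwistedGroup

/-! ### The quotient map and primeness of its kernel -/

namespace TwistedGroup

/-- Evaluation of a block-diagonal operator at a representation. -/
def UnitaryRep.eval {Γ : Type u} [Group Γ] (π : UnitaryRep Γ) :
    UniversalOperators Γ →⋆ₐ[ℂ] (π.H →L[ℂ] π.H) where
  toFun T := T π
  map_one' := rfl
  map_mul' _ _ := rfl
  map_zero' := rfl
  map_add' _ _ := rfl
  commutes' _ := rfl
  map_star' _ := rfl

lemma UnitaryRep.continuous_eval {Γ : Type u} [Group Γ] (π : UnitaryRep Γ) :
    Continuous π.eval := by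
  open scoped CStarAlgebra in exact map_continuous π.eval

lemma universalRep_mem {Γ : Type u} [Group Γ] (γ : Γ) :
    universalRep Γ γ ∈ (StarAlgebra.adjoin ℂ (Set.range (universalRep Γ))).topologicalClosure :=
  StarSubalgebra.le_topologicalClosure _ (StarAlgebra.subset_adjoin ℂ _ ⟨γ, rfl⟩)

namespace TwoCocycle

variable {G : Type u} [Group G] (σ : TwoCocycle G)

lemma regularRep_mem (g : G) :
    σ.regularRep g ∈ (StarAlgebra.adjoin ℂ (Set.range σ.regularRep)).topologicalClosure :=
  StarSubalgebra.le_topologicalClosure _ (StarAlgebra.subset_adjoin ℂ _ ⟨g, rfl⟩)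

instance : CStarAlgebra σ.ReducedCStarAlgebra :=
  StarSubalgebra.cstarAlgebra _ (h_closed := StarSubalgebra.isClosed_topologicalClosure _)

/-- The integrated form of `σ.extensionRep`, defined on all block-diagonal operators. -/
def extensionEval : UniversalOperators σ.Extension →⋆ₐ[ℂ]
    (lp (fun _ : G => ℂ) 2 →L[ℂ] lp (fun _ : G => ℂ) 2) :=
  σ.extensionRep.eval

lemma continuous_extensionEval : Continuous σ.extensionEval :=
  σ.extensionRep.continuous_eval

lemma extensionEval_mem (a : GroupCStarAlgebra σ.Extension) :
    σ.extensionEval (a : UniversalOperators σ.Extension) ∈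
      (StarAlgebra.adjoin ℂ (Set.range σ.regularRep)).topologicalClosure := by
  have hle : (StarAlgebra.adjoin ℂ (Set.range (universalRep σ.Extension))).topologicalClosure ≤
      (StarAlgebra.adjoin ℂ (Set.range σ.regularRep)).topologicalClosure.comap
        σ.extensionEval := by
    refine StarSubalgebra.topologicalClosure_minimal (StarAlgebra.adjoin_le ?_) ?_
    · rintro _ ⟨a, rfl⟩
      exact SMulMemClass.smul_mem _ (σ.regularRep_mem a.fst)
    · exact (StarSubalgebra.isClosed_topologicalClosure _).preimage σ.continuous_extensionEval
  exact hle a.2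

/-- The canonical homomorphism `C⋆(G^σ) → C⋆_r(G,σ)`. -/
def toReduced : GroupCStarAlgebra σ.Extension →⋆ₐ[ℂ] σ.ReducedCStarAlgebra :=
  StarAlgHom.codRestrict (σ.extensionEval.comp (StarSubalgebra.subtype _)) _
    σ.extensionEval_mem

lemma continuous_toReduced : Continuous σ.toReduced := by
  open scoped CStarAlgebra in exact map_continuous σ.toReduced

lemma coe_toReduced_universalRep (a : σ.Extension) :
    (σ.toReduced ⟨universalRep _ a, universalRep_mem a⟩ :
      lp (fun _ : G => ℂ) 2 →L[ℂ] lp (fun _ : G => ℂ) 2) = σ.extensionOperator a := rfl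

theorem toReduced_surjective : Function.Surjective σ.toReduced := by
  let φ := (StarSubalgebra.subtype _).comp σ.toReduced
  have hle : (StarAlgebra.adjoin ℂ (Set.range σ.regularRep)).topologicalClosure ≤ φ.range := by
    refine StarSubalgebra.topologicalClosure_minimal (StarAlgebra.adjoin_le ?_) ?_
    · rintro _ ⟨g, rfl⟩
      exact ⟨⟨universalRep _ ⟨g, 1⟩, universalRep_mem _⟩,
        (σ.regularRep_eq_extensionOperator g).symm⟩
    · exact φ.isClosed_range_of_cstarAlgebra
  intro T
  obtain ⟨a, ha⟩ := hle T.2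
  exact ⟨a, Subtype.ext ha⟩

/-- If Kleppner's condition holds, then the kernel of `C⋆(G^σ) → C⋆_r(G,σ)` is prime. -/
theorem Kleppner.isPrimeIdeal_ker {σ : TwoCocycle G} (hK : σ.Kleppner) :
    IsPrimeIdeal (TwoSidedIdeal.ker σ.toReduced) where
  isClosed := by
    have : (TwoSidedIdeal.ker σ.toReduced : Set (GroupCStarAlgebra σ.Extension)) =
        σ.toReduced ⁻¹' {0} := by
      ext a
      exact TwoSidedIdeal.mem_ker _
    rw [this]
    exact isClosed_singleton.preimage σ.continuous_toReduced
  ne_top h := by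
    have := (TwoSidedIdeal.mem_ker _).1 ((TwoSidedIdeal.one_mem_iff _).2 h)
    rw [map_one] at this
    exact one_ne_zero this
  le_or_le I J _ _ hIJ := by
    let φ : GroupCStarAlgebra σ.Extension → lp (fun _ : G => ℂ) 2 →L[ℂ] lp (fun _ : G => ℂ) 2 :=
      fun a => (σ.toReduced a : lp (fun _ : G => ℂ) 2 →L[ℂ] lp (fun _ : G => ℂ) 2)
    have hφ_mul (a b) (ξ) : φ (a * b) ξ = φ a (φ b ξ) := by
      simp only [φ, map_mul]
      rfl
    have hker (a) (ha : ∀ ξ, φ a ξ = 0) : a ∈ TwoSidedIdeal.ker σ.toReduced :=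
      (TwoSidedIdeal.mem_ker _).2 (Subtype.ext (ContinuousLinearMap.ext ha))
    let V : Submodule ℂ (lp (fun _ : G => ℂ) 2) := ⨅ a ∈ I, (φ a).ker
    have hmem (ξ) : ξ ∈ V ↔ ∀ a ∈ I, φ a ξ = 0 := by
      simp only [V, Submodule.mem_iInf]
      rfl
    have hV : IsClosed (V : Set (lp (fun _ : G => ℂ) 2)) := by
      simp only [V, Submodule.coe_iInf]
      exact isClosed_biInter fun a _ => (φ a).isClosed_ker
    have hJ (b) (hb : b ∈ J) (ξ) : φ b ξ ∈ V := by
      refine (hmem _).2 fun a ha => ?_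
      have h := (TwoSidedIdeal.mem_ker _).1 (hIJ a ha b hb)
      rw [← hφ_mul]
      simp only [φ, h]
      rfl
    have hl (g) (ξ) (hξ : ξ ∈ V) : σ.regularRep g ξ ∈ V := by
      refine (hmem _).2 fun a ha => ?_
      rw [regularRep_eq_extensionOperator, ← coe_toReduced_universalRep]
      exact (hφ_mul _ _ _).symm.trans ((hmem _).1 hξ _ (I.mul_mem_right _ _ ha))
    -- Left invariance used that `I` absorbs right multiplication; here `ρ_σ` commutes with the
    -- image.
    have hr (g) (ξ) (hξ : ξ ∈ V) : σ.rightRegularRep g ξ ∈ V := by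
      refine (hmem _).2 fun a ha => ?_
      refine (σ.apply_rightRegularRep (σ.toReduced a) g ξ).trans ?_
      exact (congrArg (σ.rightRegularRep g) ((hmem _).1 hξ a ha)).trans (map_zero _)
    rcases hK.eq_bot_or_eq_top hV hl hr with h | h
    · right
      exact fun b hb => hker b fun ξ => (Submodule.mem_bot ℂ).1 (h ▸ hJ b hb ξ)
    · left
      exact fun a ha => hker a fun ξ => (hmem ξ).1 (h ▸ Submodule.mem_top) a ha

end TwoCocycle

end TwistedGroup

end

theorem mainTheorem5 {G : Type u} [Group G] (σ : TwistedGroup.TwoCocycle G)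
    (hprime : ∀ P : TwoSidedIdeal (TwistedGroup.GroupCStarAlgebra σ.Extension),
      TwistedGroup.IsPrimeIdeal P → TwistedGroup.IsMaximalIdeal P)
    (hK : σ.Kleppner) :
    TwistedGroup.IsSimpleCStar σ.ReducedCStarAlgebra where
  nontrivial := inferInstance
  eq_bot_or_eq_top I hI := by
    refine or_iff_not_imp_right.2 fun hne => ?_
    have hmax := hprime _ hK.isPrimeIdeal_ker
    have heq : I.comap σ.toReduced = TwoSidedIdeal.ker σ.toReduced := by
      refine hmax.eq_of_le _ ?_ (fun h => hne ?_) fun a ha => ?_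
      · have : (I.comap σ.toReduced : Set (TwistedGroup.GroupCStarAlgebra σ.Extension)) =
            σ.toReduced ⁻¹' I := by
          ext a
          exact TwoSidedIdeal.mem_comap _
        rw [this]
        exact hI.preimage σ.continuous_toReduced
      · have := (TwoSidedIdeal.mem_comap _).1 ((TwoSidedIdeal.one_mem_iff _).2 h)
        rw [map_one] at this
        exact (TwoSidedIdeal.one_mem_iff _).1 this
      · rw [TwoSidedIdeal.mem_comap, (TwoSidedIdeal.mem_ker _).1 ha]
        exact I.zero_mem
    refine eq_bot_iff.2 fun T hT => ?_
    obtain ⟨a, rfl⟩ := σ.toReduced_surjective T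
    have ha : a ∈ TwoSidedIdeal.ker σ.toReduced := heq ▸ (TwoSidedIdeal.mem_comap _).2 hT
    rw [(TwoSidedIdeal.mem_ker _).1 ha]
    exact TwoSidedIdeal.zero_mem _
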